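/- Let $\Lambda$ be a nonempty index set and let $(G_\lambda,d_\lambda)_{\lambda\in\Lambda}$ be groups equipped with two-sided invariant metrics, i.e. $d_\lambda(gf_1,gf_2)=d_\lambda(f_1,f_2)=d_\lambda(f_1g,f_2g)$ for all $g,f_1,f_2\in G_\lambda$. Let $A$ be a common subgroup of all the $G_\lambda$, closed in every $(G_\lambda,d_\lambda)$, with $G_{\lambda_1}\cap G_{\lambda_2}=A$ for $\lambda_1\neq\lambda_2$, and suppose that the metrics agree on $A$: $d_{\lambda_1}(a_1,a_2)=d_{\lambda_2}(a_1,a_2)$ for all $a_1,a_2\in A$ and $\lambda_1,\lambda_2\in\Lambda$. Let $G=\bigcup_{\lambda}G_\lambda$, and let $d$ be the amalgam metric on $G$, $$d(f_1,f_2)=\begin{cases} d_\lambda(f_1,f_2) & \text{if } f_1,f_2\in G_\lambda \text{ for some }\lambda\in\Lambda,\\ \inf_{a\in A}\{d_{\lambda_1}(f_1,a)+d_{\lambda_2}(a,f_2)\} & \text{if } f_1\in G_{\lambda_1},\ f_2\in G_{\lambda_2},\ \lambda_1\neq\lambda_2.\end{cases}$$ Let $\coprod_A G_\lambda$ be the free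 product of the groups $G_\lambda$ with amalgamation over $A$. For a nonempty finite word $\alpha=\alpha(1)\cdots\alpha(n)$ over the alphabet $G$, let $|\alpha|=n$ be its length and let $\hat\alpha\in\coprod_A G_\lambda$ be the product of its letters. For two words of the same length $n$ put $\rho(\alpha_1,\alpha_2)=\sum_{i=1}^{n}d(\alpha_1(i),\alpha_2(i))$, and for $f_1,f_2\in\coprod_A G_\lambda$ put $$\underline d(f_1,f_2)=\inf\{\rho(\alpha_1,\alpha_2): |\alpha_1|=|\alpha_2|,\ \hat\alpha_1=f_1,\ \hat\alpha_2=f_2\}.$$ Then (i) $\underline d$ is a two-sided invariant metric on $\coprod_A G_\lambda$; (ii) $\underline d$ extends $d$: $\underline d(g_1,g_2)=d(g_1,g_2)$ for all $g_1,g_2\in G$, where $G$ is viewed inside $\coprod_A G_\lambda$ through its natural map. -/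

import Mathlib

/-- A distance function on a group is two-sided invariant if
`d (g f₁) (g f₂) = d f₁ f₂ = d (f₁ g) (f₂ g)` for all `g, f₁, f₂`. -/
def IsTwoSidedInvariant {H : Type*} [Mul H] (d : H → H → ℝ) : Prop :=
  ∀ g f₁ f₂ : H, d (g * f₁) (g * f₂) = d f₁ f₂ ∧ d (f₁ * g) (f₂ * g) = d f₁ f₂

namespace GraevAmalgam

section Defs

variable {ι : Type*} {G : ι → Type*} {A : Type*}
variable [∀ i, Group (G i)] [Group A]

/-- Two letters of the disjoint union of the `G i` are identified if they are the images of
the same element of the common subgroup `A`. -/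
def Glue (φ : ∀ i, A →* G i) (x y : Σ i, G i) : Prop :=
  ∃ a : A, x.2 = φ x.1 a ∧ y.2 = φ y.1 a

/-- The union `G = ⋃ G i` in which the groups `G i` are glued along `A`, so that
`G i ∩ G j = A` for `i ≠ j`.  It is the alphabet of the words below. -/
def Letters (φ : ∀ i, A →* G i) : Type _ := Quot (Glue φ)

/-- The inclusion of `G i` in the union `⋃ G i`. -/
def letter (φ : ∀ i, A →* G i) (i : ι) (g : G i) : Letters φ := Quot.mk _ ⟨i, g⟩

/-- Two letters are multipliable if they lie in one and the same `G i`. -/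
def Multipliable (φ : ∀ i, A →* G i) (x y : Letters φ) : Prop :=
  ∃ (i : ι) (g h : G i), letter φ i g = x ∧ letter φ i h = y

/-- The natural map of the union `⋃ G i` to the free product of the `G i` with amalgamation
over `A`. -/
def toAmalgam (φ : ∀ i, A →* G i) : Letters φ → Monoid.PushoutI φ :=
  Quot.lift (fun x => Monoid.PushoutI.of x.1 x.2) (by
    rintro ⟨i, g⟩ ⟨j, h⟩ ⟨a, hg, hh⟩
    dsimp only at hg hh ⊢
    rw [hg, hh, Monoid.PushoutI.of_apply_eq_base, Monoid.PushoutI.of_apply_eq_base])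

/-- The evaluation of a word: the product of its letters in the amalgam. -/
def eval (φ : ∀ i, A →* G i) (α : List (Letters φ)) : Monoid.PushoutI φ :=
  (α.map (toAmalgam φ)).prod

variable [∀ i, MetricSpace (G i)]

open Classical in
/-- The amalgam metric `d` on the union `⋃ G i`:  `d x y` is the distance of `x` and `y` in `G i`
if both lie in `G i`, and `inf_a (d_i (x, a) + d_j (a, y))` if `x ∈ G i` and `y ∈ G j` do not lie
in a common factor.  In the first case the set below has a single element, see
`amalgDist_same`; the formula of the second case is `amalgDist_of_ne`. -/
noncomputable def amalgDist (φ : ∀ i, A →* G i) (x y : Letters φ) : ℝ :=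
  if Multipliable φ x y then
    sInf {r : ℝ | ∃ (i : ι) (g h : G i), letter φ i g = x ∧ letter φ i h = y ∧ r = dist g h}
  else
    sInf {r : ℝ | ∃ (i j : ι) (g : G i) (h : G j) (a : A),
      letter φ i g = x ∧ letter φ j h = y ∧ r = dist g (φ i a) + dist (φ j a) h}

/-- `ρ (α, β) = ∑ d (α k, β k)`, used for words of the same length only. -/
noncomputable def rho (φ : ∀ i, A →* G i) (α β : List (Letters φ)) : ℝ :=
  (List.zipWith (amalgDist φ) α β).sum

/-- The Graev distance on the amalgam: the infimum of `ρ (α₁, α₂)` over the pairs of nonempty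
words of the same length that evaluate to `f₁` and `f₂`. -/
noncomputable def graevDist (φ : ∀ i, A →* G i) (f₁ f₂ : Monoid.PushoutI φ) : ℝ :=
  sInf {r : ℝ | ∃ α₁ α₂ : List (Letters φ), α₁ ≠ [] ∧ α₂ ≠ [] ∧ α₁.length = α₂.length ∧
    eval φ α₁ = f₁ ∧ eval φ α₂ = f₂ ∧ r = rho φ α₁ α₂}

end Defs

section WellDefined

variable {ι : Type*} {G : ι → Type*} {A : Type*}
variable [∀ i, Group (G i)] [Group A]

theorem letter_injective (φ : ∀ i, A →* G i) (hφ : ∀ i, Function.Injective (φ i)) (i : ι) :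
    Function.Injective (letter φ i) := by
  intro g h e
  exact Monoid.PushoutI.of_injective hφ i (congrArg (toAmalgam φ) e)

/-- In the union, `G i ∩ G j = A` for `i ≠ j`. -/
theorem letter_eq_letter_iff (φ : ∀ i, A →* G i) (hφ : ∀ i, Function.Injective (φ i)) {i j : ι}
    (hij : i ≠ j) (g : G i) (h : G j) :
    letter φ i g = letter φ j h ↔ ∃ a : A, g = φ i a ∧ h = φ j a := by
  constructor
  · intro e
    have e' : (Monoid.PushoutI.of i g : Monoid.PushoutI φ) = Monoid.PushoutI.of j h :=
      congrArg (toAmalgam φ) e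
    have hmem : (Monoid.PushoutI.of i g : Monoid.PushoutI φ) ∈
        (Monoid.PushoutI.of i).range ⊓ (Monoid.PushoutI.of (φ := φ) j).range :=
      ⟨⟨g, rfl⟩, ⟨h, e'.symm⟩⟩
    rw [Monoid.PushoutI.inf_of_range_eq_base_range hφ hij] at hmem
    obtain ⟨a, ha⟩ := hmem
    refine ⟨a, ?_, ?_⟩
    · apply Monoid.PushoutI.of_injective hφ i
      rw [Monoid.PushoutI.of_apply_eq_base, ha]
    · apply Monoid.PushoutI.of_injective hφ j
      rw [Monoid.PushoutI.of_apply_eq_base, ha, e']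
  · rintro ⟨a, hg, hh⟩
    exact Quot.sound ⟨a, hg, hh⟩

variable [∀ i, MetricSpace (G i)]

theorem dist_eq_of_letter_eq (φ : ∀ i, A →* G i) (hφ : ∀ i, Function.Injective (φ i))
    (hagree : ∀ (i j : ι) (a b : A), dist (φ i a) (φ i b) = dist (φ j a) (φ j b))
    {i j : ι} {g h : G i} {g' h' : G j}
    (hg : letter φ i g = letter φ j g') (hh : letter φ i h = letter φ j h') :
    dist g h = dist g' h' := by
  by_cases hij : i = j
  · subst hij
    rw [letter_injective φ hφ i hg, letter_injective φ hφ i hh]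
  · obtain ⟨a, rfl, rfl⟩ := (letter_eq_letter_iff φ hφ hij _ _).1 hg
    obtain ⟨b, rfl, rfl⟩ := (letter_eq_letter_iff φ hφ hij _ _).1 hh
    exact hagree i j a b

/-- The amalgam metric extends the metric of every `G i`. -/
theorem amalgDist_same (φ : ∀ i, A →* G i) (hφ : ∀ i, Function.Injective (φ i))
    (hagree : ∀ (i j : ι) (a b : A), dist (φ i a) (φ i b) = dist (φ j a) (φ j b))
    (i : ι) (g h : G i) : amalgDist φ (letter φ i g) (letter φ i h) = dist g h := by
  rw [amalgDist, if_pos ⟨i, g, h, rfl, rfl⟩]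
  have : {r : ℝ | ∃ (j : ι) (g' h' : G j), letter φ j g' = letter φ i g ∧
      letter φ j h' = letter φ i h ∧ r = dist g' h'} = {dist g h} := by
    ext r
    constructor
    · rintro ⟨j, g', h', hg, hh, rfl⟩
      exact dist_eq_of_letter_eq φ hφ hagree hg hh
    · rintro rfl
      exact ⟨i, g, h, rfl, rfl, rfl⟩
  rw [this, csInf_singleton]

/-- The amalgam metric between elements of two different factors. -/
theorem amalgDist_of_ne (φ : ∀ i, A →* G i) (hφ : ∀ i, Function.Injective (φ i))
    (hagree : ∀ (i j : ι) (a b : A), dist (φ i a) (φ i b) = dist (φ j a) (φ j b))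
    {i j : ι} (hij : i ≠ j) (g : G i) (h : G j) :
    amalgDist φ (letter φ i g) (letter φ j h) = ⨅ a : A, (dist g (φ i a) + dist (φ j a) h) := by
  have hbdd : BddBelow (Set.range fun a : A => dist g (φ i a) + dist (φ j a) h) :=
    ⟨0, by rintro _ ⟨a, rfl⟩; positivity⟩
  by_cases hm : Multipliable φ (letter φ i g) (letter φ j h)
  · have key : (∃ b, g = φ i b) ∨ (∃ b, h = φ j b) := by
      obtain ⟨k, g', h', hg, hh⟩ := hm
      by_cases hki : k = i
      · subst hki
        obtain ⟨b, -, hb⟩ := (letter_eq_letter_iff φ hφ hij _ _).1 hh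
        exact Or.inr ⟨b, hb⟩
      · obtain ⟨b, -, hb⟩ := (letter_eq_letter_iff φ hφ hki _ _).1 hg
        exact Or.inl ⟨b, hb⟩
    have glue : ∀ b : A, letter φ i (φ i b) = letter φ j (φ j b) := fun b =>
      (letter_eq_letter_iff φ hφ hij _ _).2 ⟨b, rfl, rfl⟩
    rcases key with ⟨b, rfl⟩ | ⟨b, rfl⟩
    · rw [glue b, amalgDist_same φ hφ hagree]
      apply le_antisymm
      · refine le_ciInf fun a => ?_
        rw [hagree i j b a]
        exact dist_triangle _ _ _
      · refine (ciInf_le hbdd b).trans ?_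
        simp
    · rw [← glue b, amalgDist_same φ hφ hagree]
      apply le_antisymm
      · refine le_ciInf fun a => ?_
        rw [hagree j i a b]
        exact dist_triangle _ _ _
      · refine (ciInf_le hbdd b).trans ?_
        simp
  · rw [amalgDist, if_neg hm, iInf]
    congr 1
    ext r
    constructor
    · rintro ⟨i', j', g', h', a, hg, hh, rfl⟩
      have hi : i' = i := by
        by_contra hne
        obtain ⟨b, -, rfl⟩ := (letter_eq_letter_iff φ hφ hne _ _).1 hg
        exact hm ⟨j, φ j b, h,
          (letter_eq_letter_iff φ hφ hij.symm _ _).2 ⟨b, rfl, rfl⟩, rfl⟩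
      have hj : j' = j := by
        by_contra hne
        obtain ⟨b, -, rfl⟩ := (letter_eq_letter_iff φ hφ hne _ _).1 hh
        exact hm ⟨i, g, φ i b, rfl,
          (letter_eq_letter_iff φ hφ hij _ _).2 ⟨b, rfl, rfl⟩⟩
      subst hi hj
      rw [letter_injective φ hφ _ hg, letter_injective φ hφ _ hh]
      exact ⟨a, rfl⟩
    · rintro ⟨a, rfl⟩
      exact ⟨i, j, g, h, a, rfl, rfl, rfl⟩

end WellDefined

end GraevAmalgam

/-!
That the Graev distance is a two-sided invariant pseudometric is formal: concatenating words gives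
`d (f₁ g₁, f₂ g₂) ≤ d (f₁, f₂) + d (g₁, g₂)`, and invariance and the triangle inequality follow.
The content lies in the lower bounds: the Graev distance of two letters is not smaller than their
amalgam distance, and distinct elements have positive distance.

Both follow from a calculus of contractions.  A word over the disjoint union of the factors is
contracted to an element of one factor by multiplying consecutive blocks, by moving an element
inside its factor at the cost of the distance, and by passing an element of the common subgroup
`A` to another factor (`GraevAmalgam.Contracts`).  The key point is that the possible outcomes and
costs depend only on the product of the word in the amalgam (`Contracts.of_wordProd_eq`).  For
this, one has to show that two adjacent letters `g, h` of a factor may be replaced by the letter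
`g h` (`Contracts.merge`).  This is a cut elimination: in a derivation in which `g` and `h` are
contracted in different blocks, two-sided invariance allows each of them to be solved for
(`Contracts.last_letter`, `Contracts.first_letter`), after which the product is inserted.

Replacing a letter by another one changes the cost by at most their amalgam distance, so a
contraction of a word `α₁` with product `f₁` yields one of every word with product `f₂`, at an
additional cost arbitrarily close to the Graev distance of `f₁` and `f₂`
(`Contracts.of_graevDist_lt`).  It remains to look at contractions of special words.  One letter
contracts to another one only at a cost of at least their amalgam distance
(`Contracts.amalgDist_le`), which gives the extension property.  A reduced word with letters at
distance at least `δ` from `A` contracts to no element of `A` at a cost below `δ`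
(`Contracts.eq_nil_or_singleton`), which, `A` being closed, gives positivity.
-/

namespace GraevAmalgam

/-! ### Contractions of words over the disjoint union of the factors -/

section Contraction

variable {ι : Type*} {G : ι → Type*} {A : Type*}
variable [∀ i, Group (G i)] [Group A] [∀ i, MetricSpace (G i)]

/-- `Contracts φ w i g r`: the word `w` over the disjoint union of the factors can be contracted to
the single element `g` of `G i` at total cost at most `r`.  Consecutive contracted blocks in the
same factor may be multiplied, an element may be moved inside its factor at the cost of the
distance, and an element of the common subgroup may be regarded as an element of another factor
for free.  There is deliberately no rule that factors a letter: derivations follow the nesting of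
blocks in `w`, which makes it possible to read off what a short or reduced word contracts to. -/
inductive Contracts (φ : ∀ i, A →* G i) : List (Σ i, G i) → (i : ι) → G i → ℝ → Prop
  | nil (i : ι) : Contracts φ [] i 1 0
  | single (i : ι) (g : G i) : Contracts φ [⟨i, g⟩] i g 0
  | mul {v w : List (Σ i, G i)} {i : ι} {g h : G i} {r s : ℝ} :
      Contracts φ v i g r → Contracts φ w i h s → Contracts φ (v ++ w) i (g * h) (r + s)
  | move {w : List (Σ i, G i)} {i : ι} {g h : G i} {r s : ℝ} :
      Contracts φ w i g r → dist g h ≤ s → Contracts φ w i h (r + s)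
  | glue {w : List (Σ i, G i)} {i : ι} (j : ι) {a : A} {r : ℝ} :
      Contracts φ w i (φ i a) r → Contracts φ w j (φ j a) r

namespace Contracts

variable {φ : ∀ i, A →* G i}

theorem mono {w : List (Σ i, G i)} {i : ι} {g : G i} {r s : ℝ} (h : Contracts φ w i g r)
    (hrs : r ≤ s) : Contracts φ w i g s := by
  simpa using h.move (h := g) (s := s - r) (by simpa using hrs)

theorem nonneg {w : List (Σ i, G i)} {i : ι} {g : G i} {r : ℝ} (h : Contracts φ w i g r) :
    0 ≤ r := by
  induction h with
  | nil | single => exact le_rfl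
  | mul _ _ h₁ h₂ => exact add_nonneg h₁ h₂
  | move _ hd h => exact add_nonneg h (dist_nonneg.trans hd)
  | glue _ _ h => exact h

theorem one_glue {w : List (Σ i, G i)} {i : ι} (j : ι) {r : ℝ} (h : Contracts φ w i 1 r) :
    Contracts φ w j 1 r := by
  rw [← map_one (φ i)] at h
  simpa using h.glue j

/-- Replacing a letter of a word by a word that contracts to it. -/
theorem subst {p q u : List (Σ i, G i)} {i k : ι} {g : G i} {x : G k} {r s : ℝ}
    (h : Contracts φ (p ++ ⟨i, g⟩ :: q) k x r) (hu : Contracts φ u i g s) :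
    Contracts φ (p ++ (u ++ q)) k x (r + s) := by
  generalize hw : p ++ ⟨i, g⟩ :: q = w at h
  induction h generalizing p q with
  | nil => simp at hw
  | single k x =>
    obtain ⟨rfl, h, rfl⟩ : p = [] ∧ (⟨i, g⟩ : Σ i, G i) = ⟨k, x⟩ ∧ q = [] := by
      cases p <;> simp_all
    cases h
    simpa using hu
  | @mul v w k x y r₁ r₂ hv hw' ihv ihw =>
    rw [List.append_eq_append_iff] at hw
    rcases hw with ⟨t, rfl, ht⟩ | ⟨t, rfl, rfl⟩
    · rcases List.cons_eq_append_iff.1 ht with ⟨rfl, rfl⟩ | ⟨t', rfl, rfl⟩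
      · exact (by simpa using hv.mul (ihw (p := []) rfl) : Contracts φ _ _ _ _).mono (by linarith)
      · exact (by simpa using (ihv rfl).mul hw' : Contracts φ _ _ _ _).mono (by linarith)
    · exact (by simpa using hv.mul (ihw rfl) : Contracts φ _ _ _ _).mono (by linarith)
  | move hw' hd ih => exact ((ih hw).move hd).mono (by linarith)
  | glue j hw' ih => exact (ih hw).glue j

variable (htsi : ∀ i, IsTwoSidedInvariant (fun x y : G i => dist x y))
  (hagree : ∀ (i j : ι) (a b : A), dist (φ i a) (φ i b) = dist (φ j a) (φ j b))

include htsi in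
theorem dist_mul_mul_le {i : ι} (a b c d : G i) :
    dist (a * b) (c * d) ≤ dist a c + dist b d := by
  have h₁ : dist (a * b) (c * b) = dist a c := (htsi i b a c).2
  have h₂ : dist (c * b) (c * d) = dist b d := (htsi i c b d).1
  linarith [dist_triangle (a * b) (c * b) (c * d)]

include htsi hagree in
theorem dist_one_le_of_nil {k : ι} {x : G k} {r : ℝ} (h : Contracts φ [] k x r) :
    dist 1 x ≤ r := by
  generalize hw : [] = w at h
  induction h with
  | nil => simp
  | single => simp at hw
  | @mul v w k x y r₁ r₂ hv hw' ihv ihw =>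
    obtain ⟨rfl, rfl⟩ := List.append_eq_nil_iff.1 hw.symm
    have := dist_mul_mul_le htsi 1 1 x y
    rw [mul_one] at this
    linarith [ihv rfl, ihw rfl]
  | @move w i g h r s hw' hd ih => linarith [ih hw, dist_triangle 1 g h]
  | @glue w i j a r hw' ih =>
    have := hagree i j 1 a
    simp only [map_one] at this
    rw [← this]
    exact ih hw

include htsi hagree in
/-- Inversion at the last letter.  In a derivation for `p ++ [g]`, either `g` is multiplied with
the rest of the word inside the factor of the outcome, or `g` closes a block `p₂ ++ [g]` which
is contracted to an element `a` of the common subgroup before it is glued to another factor.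
Solving for the rest of the word gives contractions that do not mention `g`. -/
theorem last_letter {p : List (Σ i, G i)} {i k : ι} {g : G i} {x : G k} {r : ℝ}
    (h : Contracts φ (p ++ [⟨i, g⟩]) k x r) :
    (∃ y : G i, (⟨k, x⟩ : Σ i, G i) = ⟨i, y⟩ ∧ Contracts φ p i (y * g⁻¹) r) ∨
      ∃ (p₁ p₂ : List (Σ i, G i)) (a : A) (r₁ r₂ : ℝ), p = p₁ ++ p₂ ∧ r = r₁ + r₂ ∧
        Contracts φ p₁ k (x * φ k a⁻¹) r₁ ∧ Contracts φ p₂ i (φ i a * g⁻¹) r₂ := by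
  generalize hw : p ++ [⟨i, g⟩] = w at h
  induction h generalizing p with
  | nil => simp at hw
  | single k x =>
    obtain ⟨rfl, h⟩ : p = [] ∧ (⟨i, g⟩ : Σ i, G i) = ⟨k, x⟩ := by
      cases p <;> simp_all
    cases h
    exact Or.inl ⟨g, rfl, by simpa using nil i⟩
  | @mul v w k x y r₁ r₂ hv hw' ihv ihw =>
    -- If the second block is empty, the letter lies in the first one; the second outcome `y` then
    -- satisfies `dist 1 y ≤ r₂`, so that multiplication by it is a move of cost `r₂`.
    rcases w.eq_nil_or_concat with rfl | ⟨w, c, rfl⟩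
    · have hy := dist_one_le_of_nil htsi hagree hw'
      have key : ∀ z : G k, dist (x * z) (x * y * z) ≤ r₂ := fun z => by
        have h₁ : dist (x * z) (x * y * z) = dist z (y * z) := by
          simpa [mul_assoc] using (htsi k x z (y * z)).1
        have h₂ : dist (1 * z) (y * z) = dist 1 y := (htsi k z 1 y).2
        rw [one_mul] at h₂
        linarith
      rcases ihv (by simpa using hw) with ⟨z, hz, hp⟩ | ⟨p₁, p₂, a, s₁, s₂, rfl, rfl, h₁, h₂⟩
      · cases hz
        exact Or.inl ⟨_, rfl, hp.move (key _)⟩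
      · exact Or.inr ⟨p₁, p₂, a, s₁ + r₂, s₂, rfl, by ring, h₁.move (key _), h₂⟩
    · rw [List.concat_eq_append, ← List.append_assoc] at hw
      obtain ⟨rfl, hc⟩ := List.append_inj' hw rfl
      simp only [List.cons.injEq, and_true] at hc
      subst hc
      rcases ihw (p := w) (by simp) with ⟨z, hz, hp⟩ | ⟨p₁, p₂, a, s₁, s₂, rfl, rfl, h₁, h₂⟩
      · cases hz
        exact Or.inl ⟨_, rfl, by simpa [mul_assoc] using hv.mul hp⟩
      · exact Or.inr ⟨v ++ p₁, p₂, a, r₁ + s₁, s₂, by simp, by ring,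
          by simpa [mul_assoc] using hv.mul h₁, h₂⟩
  | @move w k x y r s hw' hd ih =>
    have key : ∀ z : G k, dist (x * z) (y * z) ≤ s := fun z => ((htsi k z x y).2).trans_le hd
    rcases ih hw with ⟨z, hz, hp⟩ | ⟨p₁, p₂, a, s₁, s₂, rfl, rfl, h₁, h₂⟩
    · cases hz
      exact Or.inl ⟨_, rfl, hp.move (key _)⟩
    · exact Or.inr ⟨p₁, p₂, a, s₁ + s, s₂, rfl, by ring, h₁.move (key _), h₂⟩
  | @glue w k j b r hw' ih =>
    rcases ih hw with ⟨z, hz, hp⟩ | ⟨p₁, p₂, a, s₁, s₂, rfl, rfl, h₁, h₂⟩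
    · cases hz
      -- The glued element is the element of the common subgroup that closes the block `p ++ [g]`.
      exact Or.inr ⟨[], p, b, 0, r, by simp, by ring, by simpa using nil j, hp⟩
    · refine Or.inr ⟨p₁, p₂, a, s₁, s₂, rfl, rfl, ?_, h₂⟩
      rw [← map_mul] at h₁ ⊢
      exact h₁.glue j

include htsi hagree in
/-- Inversion at the first letter, the mirror image of `last_letter`. -/
theorem first_letter {q : List (Σ i, G i)} {i k : ι} {g : G i} {x : G k} {r : ℝ}
    (h : Contracts φ (⟨i, g⟩ :: q) k x r) :
    (∃ y : G i, (⟨k, x⟩ : Σ i, G i) = ⟨i, y⟩ ∧ Contracts φ q i (g⁻¹ * y) r) ∨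
      ∃ (q₁ q₂ : List (Σ i, G i)) (a : A) (r₁ r₂ : ℝ), q = q₁ ++ q₂ ∧ r = r₁ + r₂ ∧
        Contracts φ q₁ i (g⁻¹ * φ i a) r₁ ∧ Contracts φ q₂ k (φ k a⁻¹ * x) r₂ := by
  generalize hw : ⟨i, g⟩ :: q = w at h
  induction h generalizing q with
  | nil => simp at hw
  | single k x =>
    obtain ⟨h, rfl⟩ : (⟨i, g⟩ : Σ i, G i) = ⟨k, x⟩ ∧ q = [] := by simp_all
    cases h
    exact Or.inl ⟨g, rfl, by simpa using nil i⟩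
  | @mul v w k x y r₁ r₂ hv hw' ihv ihw =>
    rcases List.cons_eq_append_iff.1 hw with ⟨rfl, rfl⟩ | ⟨v, rfl, rfl⟩
    · have hx := dist_one_le_of_nil htsi hagree hv
      have key : ∀ z : G k, dist (z * y) (z * (x * y)) ≤ r₁ := fun z => by
        have h₁ : dist (z * y) (z * (x * y)) = dist y (x * y) := (htsi k z y (x * y)).1
        have h₂ : dist (1 * y) (x * y) = dist 1 x := (htsi k y 1 x).2
        rw [one_mul] at h₂
        linarith
      rcases ihw rfl with ⟨z, hz, hp⟩ | ⟨q₁, q₂, a, s₁, s₂, rfl, rfl, h₁, h₂⟩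
      · cases hz
        exact Or.inl ⟨_, rfl, (hp.move (key _)).mono (by linarith)⟩
      · exact Or.inr ⟨q₁, q₂, a, s₁, s₂ + r₁, rfl, by ring, h₁, h₂.move (key _)⟩
    · rcases ihv rfl with ⟨z, hz, hp⟩ | ⟨q₁, q₂, a, s₁, s₂, rfl, rfl, h₁, h₂⟩
      · cases hz
        exact Or.inl ⟨_, rfl, by simpa [mul_assoc] using hp.mul hw'⟩
      · exact Or.inr ⟨q₁, q₂ ++ w, a, s₁, s₂ + r₂, by simp, by ring, h₁,
          by simpa [mul_assoc] using h₂.mul hw'⟩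
  | @move w k x y r s hw' hd ih =>
    have key : ∀ z : G k, dist (z * x) (z * y) ≤ s := fun z => ((htsi k z x y).1).trans_le hd
    rcases ih hw with ⟨z, hz, hp⟩ | ⟨q₁, q₂, a, s₁, s₂, rfl, rfl, h₁, h₂⟩
    · cases hz
      exact Or.inl ⟨_, rfl, hp.move (key _)⟩
    · exact Or.inr ⟨q₁, q₂, a, s₁, s₂ + s, rfl, by ring, h₁, h₂.move (key _)⟩
  | @glue w k j b r hw' ih =>
    rcases ih hw with ⟨z, hz, hp⟩ | ⟨q₁, q₂, a, s₁, s₂, rfl, rfl, h₁, h₂⟩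
    · cases hz
      -- The glued element is the element of the common subgroup that closes the block `g :: q`.
      exact Or.inr ⟨q, [], b, r, 0, by simp, by ring, hp, by simpa using nil j⟩
    · refine Or.inr ⟨q₁, q₂, a, s₁, s₂, rfl, rfl, h₁, ?_⟩
      rw [← map_mul] at h₂ ⊢
      exact h₂.glue j

include htsi hagree in
/-- The case of `merge` in which the two letters belong to different blocks.  The two inversion
lemmas isolate the contributions of `g` and `h`, between which `g * h` is inserted. -/
theorem mul_merge {p q : List (Σ i, G i)} {i k : ι} {g h : G i} {x y : G k} {r s : ℝ}
    (hp : Contracts φ (p ++ [⟨i, g⟩]) k x r) (hq : Contracts φ (⟨i, h⟩ :: q) k y s) :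
    Contracts φ (p ++ ⟨i, g * h⟩ :: q) k (x * y) (r + s) := by
  have mid := single (φ := φ) i (g * h)
  rcases last_letter htsi hagree hp with ⟨x, hx, hp'⟩ | ⟨p₁, p₂, a, r₁, r₂, rfl, rfl, hp₁, hp₂⟩
  · cases hx
    rcases first_letter htsi hagree hq with ⟨y, hy, hq'⟩ | ⟨q₁, q₂, b, s₁, s₂, rfl, rfl, hq₁, hq₂⟩
    · cases hy
      simpa [mul_assoc] using (hp'.mul mid).mul hq'
    · have := ((hp'.mul mid).mul hq₁).mul hq₂
      simpa [mul_assoc, add_assoc] using this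
  · rcases first_letter htsi hagree hq with ⟨y, hy, hq'⟩ | ⟨q₁, q₂, b, s₁, s₂, rfl, rfl, hq₁, hq₂⟩
    · cases hy
      simpa [mul_assoc, add_assoc] using hp₁.mul ((hp₂.mul mid).mul hq')
    · have := (hp₂.mul mid).mul hq₁
      have e : φ i a * g⁻¹ * (g * h) * (h⁻¹ * φ i b) = φ i (a * b) := by simp [mul_assoc]
      rw [e] at this
      simpa [mul_assoc, add_assoc] using (hp₁.mul (this.glue k)).mul hq₂

include htsi hagree in
/-- Two adjacent letters of one factor may be replaced by their product without a change of cost.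
This is the admissibility of the rule that factors a letter. -/
theorem merge {p q : List (Σ i, G i)} {i k : ι} {g h : G i} {x : G k} {r : ℝ}
    (hc : Contracts φ (p ++ ⟨i, g⟩ :: ⟨i, h⟩ :: q) k x r) :
    Contracts φ (p ++ ⟨i, g * h⟩ :: q) k x r := by
  generalize hw : p ++ ⟨i, g⟩ :: ⟨i, h⟩ :: q = w at hc
  induction hc generalizing p q with
  | nil => simp at hw
  | single k x =>
    have := congrArg List.length hw
    simp at this
    omega
  | @mul v w k x y r₁ r₂ hv hw' ihv ihw =>
    rw [List.append_eq_append_iff] at hw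
    rcases hw with ⟨t, rfl, ht⟩ | ⟨t, rfl, rfl⟩
    · rcases List.cons_eq_append_iff.1 ht with ⟨rfl, rfl⟩ | ⟨t', rfl, ht'⟩
      · simpa using hv.mul (ihw (p := []) rfl)
      · rcases List.cons_eq_append_iff.1 ht' with ⟨rfl, rfl⟩ | ⟨t, rfl, rfl⟩
        · exact mul_merge htsi hagree hv hw'
        · simpa using (ihv rfl).mul hw'
    · simpa using hv.mul (ihw rfl)
  | move hw' hd ih => exact (ih hw).move hd
  | glue j hw' ih => exact (ih hw).glue j

theorem insert_one {p q : List (Σ i, G i)} {k : ι} {x : G k} {r : ℝ} (i : ι)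
    (h : Contracts φ (p ++ q) k x r) : Contracts φ (p ++ ⟨i, 1⟩ :: q) k x r := by
  have one (j : ι) : Contracts φ [⟨i, 1⟩] j 1 0 := (single i 1).one_glue j
  cases q with
  | nil => simpa using h.mul (one k)
  | cons c q =>
    have hc := (one c.1).mul (single c.1 c.2)
    rw [one_mul] at hc
    simpa using h.subst hc

end Contracts

end Contraction

/-! ### Contractions depend only on the product of the word in the amalgam -/

section Invariance

open Monoid

variable {ι : Type*} {G : ι → Type*} {A : Type*}
variable [∀ i, Group (G i)] [Group A]
variable {φ : ∀ i, A →* G i}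

/-- The product in the amalgam of a word over the disjoint union of the factors. -/
def wordProd (φ : ∀ i, A →* G i) (w : List (Σ i, G i)) : PushoutI φ :=
  (w.map fun c => PushoutI.of c.1 c.2).prod

theorem wordProd_append (v w : List (Σ i, G i)) :
    wordProd φ (v ++ w) = wordProd φ v * wordProd φ w := by
  simp [wordProd]

variable [∀ i, MetricSpace (G i)]

/-- Two words are congruent if they can be exchanged inside every word without affecting any
contraction. -/
def contractsCon (φ : ∀ i, A →* G i) : Con (FreeMonoid (Σ i, G i)) where
  r v w := ∀ (p q : List (Σ i, G i)) (k : ι) (x : G k) (r : ℝ),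
    Contracts φ (p ++ (v.toList ++ q)) k x r ↔ Contracts φ (p ++ (w.toList ++ q)) k x r
  iseqv := ⟨fun _ _ _ _ _ _ => Iff.rfl, fun h p q k x r => (h p q k x r).symm,
    fun h h' p q k x r => (h p q k x r).trans (h' p q k x r)⟩
  mul' := by
    intro v v' w w' h h' p q k x r
    have h₁ := h p (w.toList ++ q) k x r
    have h₂ := h' (p ++ v'.toList) q k x r
    simp only [List.append_assoc] at h₂
    simpa using h₁.trans h₂

section
variable (htsi : ∀ i, IsTwoSidedInvariant (fun x y : G i => dist x y))
  (hagree : ∀ (i j : ι) (a b : A), dist (φ i a) (φ i b) = dist (φ j a) (φ j b))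

/-- The class of the one-letter word, as a homomorphism from a factor to the quotient by
`contractsCon`.  Multiplicativity is where `Contracts.merge` enters. -/
def letterHom (i : ι) : G i →* (contractsCon φ).Quotient where
  toFun g := (FreeMonoid.of ⟨i, g⟩ : FreeMonoid (Σ i, G i))
  map_one' := by
    refine (Con.eq _).2 fun p q k x r => ⟨fun h => ?_, fun h => ?_⟩
    · simpa using Contracts.subst (u := []) (by simpa using h) (.nil i)
    · simpa using Contracts.insert_one i (by simpa using h)
  map_mul' g g' := by
    refine (Con.eq _).2 fun p q k x r => ⟨fun h => ?_, fun h => ?_⟩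
    · simpa using Contracts.subst (by simpa using h)
        ((Contracts.single (φ := φ) i g).mul (.single i g'))
    · simpa using Contracts.merge htsi hagree (by simpa using h)

theorem letterHom_glue (i j : ι) (a : A) :
    letterHom htsi hagree i (φ i a) = letterHom htsi hagree j (φ j a) := by
  have key (i j : ι) (p q : List (Σ i, G i)) (k : ι) (x : G k) (r : ℝ)
      (h : Contracts φ (p ++ ⟨i, φ i a⟩ :: q) k x r) :
      Contracts φ (p ++ ⟨j, φ j a⟩ :: q) k x r := by
    simpa using h.subst ((Contracts.single j (φ j a)).glue i)
  exact (Con.eq _).2 fun p q k x r => ⟨key i j p q k x r, key j i p q k x r⟩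

include htsi hagree in
/-- The universal property of the amalgam yields a homomorphism to the quotient by `contractsCon`
that sends the product of a word to the class of the word. -/
theorem Contracts.of_wordProd_eq {v w : List (Σ i, G i)} {k : ι} {x : G k} {r : ℝ}
    (h : Contracts φ v k x r) (hvw : wordProd φ v = wordProd φ w) : Contracts φ w k x r := by
  let Ψ : PushoutI φ →* (contractsCon φ).Quotient :=
    PushoutI.lift (letterHom htsi hagree) ((letterHom htsi hagree k).comp (φ k)) fun i =>
      MonoidHom.ext fun a => letterHom_glue htsi hagree i k a
  have key (w : List (Σ i, G i)) :
      Ψ (wordProd φ w) = (FreeMonoid.ofList w : FreeMonoid (Σ i, G i)) := by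
    induction w with
    | nil => simp [wordProd]
    | cons c w ih =>
      rw [← List.singleton_append, wordProd_append, map_mul, ih, FreeMonoid.ofList_append,
        Con.coe_mul]
      congr 1
  have e := congrArg Ψ hvw
  rw [key, key] at e
  simpa using ((Con.eq _).1 e [] [] k x r).1 (by simpa using h)

end

end Invariance

/-! ### The amalgam metric and contractions of short and of reduced words -/

section AmalgDist

variable {ι : Type*} {G : ι → Type*} {A : Type*}
variable [∀ i, Group (G i)] [Group A] 
variable (φ : ∀ i, A →* G i)

theorem exists_letter_eq (x : Letters φ) : ∃ (i : ι) (g : G i), letter φ i g = x :=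
  Quot.inductionOn x fun c => ⟨c.1, c.2, rfl⟩

variable [∀ i, MetricSpace (G i)]

theorem amalgDist_comm (x y : Letters φ) : amalgDist φ x y = amalgDist φ y x := by
  have hm : Multipliable φ x y ↔ Multipliable φ y x :=
    ⟨fun ⟨i, g, h, hg, hh⟩ => ⟨i, h, g, hh, hg⟩, fun ⟨i, g, h, hg, hh⟩ => ⟨i, h, g, hh, hg⟩⟩
  unfold amalgDist
  rw [propext hm]
  congr 2 <;> ext r <;> constructor
  · rintro ⟨i, g, h, hg, hh, rfl⟩
    exact ⟨i, h, g, hh, hg, dist_comm _ _⟩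
  · rintro ⟨i, g, h, hg, hh, rfl⟩
    exact ⟨i, h, g, hh, hg, dist_comm _ _⟩
  · rintro ⟨i, j, g, h, a, hg, hh, rfl⟩
    exact ⟨j, i, h, g, a, hh, hg, by rw [add_comm, dist_comm h, dist_comm g]⟩
  · rintro ⟨i, j, g, h, a, hg, hh, rfl⟩
    exact ⟨j, i, h, g, a, hh, hg, by rw [add_comm, dist_comm h, dist_comm g]⟩

theorem amalgDist_nonneg (x y : Letters φ) : 0 ≤ amalgDist φ x y := by
  unfold amalgDist
  split_ifs
  · exact Real.sInf_nonneg (by rintro _ ⟨i, g, h, -, -, rfl⟩; positivity)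
  · exact Real.sInf_nonneg (by rintro _ ⟨i, j, g, h, a, -, -, rfl⟩; positivity)

variable {φ} (hφ : ∀ i, Function.Injective (φ i))
  (hagree : ∀ (i j : ι) (a b : A), dist (φ i a) (φ i b) = dist (φ j a) (φ j b))

include hφ hagree in
theorem amalgDist_self (x : Letters φ) : amalgDist φ x x = 0 := by
  obtain ⟨i, g, rfl⟩ := exists_letter_eq φ x
  rw [amalgDist_same φ hφ hagree, dist_self]

include hφ hagree in
theorem amalgDist_letter_le_add_dist (x : Letters φ) {k : ι} (g h : G k) :
    amalgDist φ x (letter φ k h) ≤ amalgDist φ x (letter φ k g) + dist g h := by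
  obtain ⟨j, f, rfl⟩ := exists_letter_eq φ x
  by_cases hjk : j = k
  · subst hjk
    simp only [amalgDist_same φ hφ hagree]
    exact dist_triangle _ _ _
  · rw [amalgDist_of_ne φ hφ hagree hjk, amalgDist_of_ne φ hφ hagree hjk, ← sub_le_iff_le_add]
    refine le_ciInf fun a => ?_
    have : ⨅ a : A, (dist f (φ j a) + dist (φ k a) h) ≤ dist f (φ j a) + dist (φ k a) h :=
      ciInf_le ⟨0, by rintro _ ⟨a, rfl⟩; positivity⟩ a
    linarith [dist_triangle (φ k a) g h]

include hφ hagree in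
theorem Contracts.of_amalgDist_lt {i j : ι} {g : G i} {h : G j} {t : ℝ}
    (ht : amalgDist φ (letter φ i g) (letter φ j h) < t) : Contracts φ [⟨i, g⟩] j h t := by
  by_cases hij : i = j
  · subst hij
    rw [amalgDist_same φ hφ hagree] at ht
    simpa using (Contracts.single i g).move ht.le
  · rw [amalgDist_of_ne φ hφ hagree hij] at ht
    obtain ⟨a, ha⟩ := exists_lt_of_ciInf_lt ht
    exact ((((Contracts.single i g).move le_rfl).glue j).move le_rfl).mono (by linarith)

variable (htsi : ∀ i, IsTwoSidedInvariant (fun x y : G i => dist x y))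

include hφ hagree htsi in
theorem Contracts.amalgDist_le {i k : ι} {g : G i} {x : G k} {r : ℝ}
    (h : Contracts φ [⟨i, g⟩] k x r) : amalgDist φ (letter φ i g) (letter φ k x) ≤ r := by
  generalize hw : [(⟨i, g⟩ : Σ i, G i)] = w at h
  induction h with
  | nil => simp at hw
  | single k x =>
    cases hw
    exact (amalgDist_self hφ hagree _).le
  | @mul v w k x y r₁ r₂ hv hw' ihv ihw =>
    rcases List.singleton_eq_append_iff.1 hw with ⟨rfl, rfl⟩ | ⟨rfl, rfl⟩
    · have h₁ := hv.dist_one_le_of_nil htsi hagree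
      have h₂ := Contracts.dist_mul_mul_le htsi 1 y x y
      rw [one_mul, dist_self] at h₂
      linarith [ihw rfl, amalgDist_letter_le_add_dist hφ hagree (letter φ i g) y (x * y)]
    · have h₁ := hw'.dist_one_le_of_nil htsi hagree
      have h₂ := Contracts.dist_mul_mul_le htsi x 1 x y
      rw [mul_one, dist_self] at h₂
      linarith [ihv rfl, amalgDist_letter_le_add_dist hφ hagree (letter φ i g) x (x * y)]
  | @move w k x y r s hw' hd ih =>
    linarith [ih hw, amalgDist_letter_le_add_dist hφ hagree (letter φ i g) x y]
  | @glue w k j a r hw' ih =>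
    have : letter φ j (φ j a) = letter φ k (φ k a) := Quot.sound ⟨a, rfl, rfl⟩
    rw [this]
    exact ih hw

include htsi hagree in
/-- If the letters of a word alternate between factors and stay at distance at least `δ` from the
common subgroup, then a contraction of cost less than `δ` never reaches that subgroup, hence
never glues a nonempty block and never joins two letters. -/
theorem Contracts.eq_nil_or_singleton {w : List (Σ i, G i)} {k : ι} {x : G k} {r δ : ℝ}
    (hw : w.IsChain fun c c' => c.1 ≠ c'.1) (hδ : ∀ c ∈ w, ∀ a : A, δ ≤ dist c.2 (φ c.1 a))
    (hr : r < δ) (h : Contracts φ w k x r) :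
    (w = [] ∧ dist 1 x ≤ r) ∨ ∃ g : G k, w = [⟨k, g⟩] ∧ dist g x ≤ r := by
  induction h with
  | nil => simp
  | single k x => exact Or.inr ⟨x, rfl, by simp⟩
  | @mul v w k x y r₁ r₂ hv hw' ihv ihw =>
    have h₁ := hv.nonneg
    have h₂ := hw'.nonneg
    rcases ihv hw.left_of_append (fun c hc => hδ c (by simp [hc])) (by linarith) with
      ⟨rfl, hx⟩ | ⟨g, rfl, hx⟩ <;>
    rcases ihw hw.right_of_append (fun c hc => hδ c (by simp [hc])) (by linarith) with
      ⟨rfl, hy⟩ | ⟨h, rfl, hy⟩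
    · left
      have := dist_mul_mul_le htsi 1 1 x y
      rw [mul_one] at this
      exact ⟨rfl, by linarith⟩
    · right
      have := dist_mul_mul_le htsi 1 h x y
      rw [one_mul] at this
      exact ⟨h, rfl, by linarith⟩
    · right
      have := dist_mul_mul_le htsi g 1 x y
      rw [mul_one] at this
      exact ⟨g, rfl, by linarith⟩
    · simp at hw
  | @move w k x y r s hw' hd ih =>
    have hs : 0 ≤ s := dist_nonneg.trans hd
    rcases ih hw hδ (by linarith) with ⟨rfl, hx⟩ | ⟨g, rfl, hx⟩
    · exact Or.inl ⟨rfl, by linarith [dist_triangle 1 x y]⟩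
    · exact Or.inr ⟨g, rfl, by linarith [dist_triangle g x y]⟩
  | @glue w k j a r hw' ih =>
    rcases ih hw hδ hr with ⟨rfl, hx⟩ | ⟨g, rfl, hx⟩
    · have := hagree k j 1 a
      simp only [map_one] at this
      exact Or.inl ⟨rfl, this ▸ hx⟩
    · linarith [hδ ⟨k, g⟩ (by simp) a]

end AmalgDist

/-! ### The Graev distance -/

section GraevDist

open Monoid

variable {ι : Type*} {G : ι → Type*} {A : Type*}
variable [∀ i, Group (G i)] [Group A]
variable {φ : ∀ i, A →* G i}

/-- A chosen representative of a letter in the disjoint union of the factors; the choice matters only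
for elements of the common subgroup. -/
noncomputable def rep (x : Letters φ) : Σ i, G i := Quot.out x

theorem letter_rep (x : Letters φ) : letter φ (rep x).1 (rep x).2 = x := Quot.out_eq x

theorem toAmalgam_letter (i : ι) (g : G i) : toAmalgam φ (letter φ i g) = PushoutI.of i g := rfl

theorem eval_eq_wordProd (α : List (Letters φ)) : eval φ α = wordProd φ (α.map rep) := by
  rw [eval, wordProd, List.map_map]
  congr 1
  refine List.map_congr_left fun x _ => ?_
  rw [← letter_rep x, toAmalgam_letter, letter_rep]
  rfl

theorem eval_append (α β : List (Letters φ)) :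
    eval φ (α ++ β) = eval φ α * eval φ β := by
  simp [eval]

theorem exists_eval_eq [Nonempty ι] (f : PushoutI φ) : ∃ α : List (Letters φ), eval φ α = f := by
  induction f using PushoutI.induction_on with
  | of i g => exact ⟨[letter φ i g], by simp [eval, toAmalgam_letter]⟩
  | base a =>
    obtain ⟨i⟩ := ‹Nonempty ι›
    exact ⟨[letter φ i (φ i a)],
      by simp [eval, toAmalgam_letter, PushoutI.of_apply_eq_base]⟩
  | mul f g hf hg =>
    obtain ⟨α, rfl⟩ := hf
    obtain ⟨β, rfl⟩ := hg
    exact ⟨α ++ β, eval_append α β⟩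

theorem exists_eval_eq_length_eq [Nonempty ι] (f₁ f₂ : PushoutI φ) : ∃ α₁ α₂ : List (Letters φ),
    α₁ ≠ [] ∧ α₂ ≠ [] ∧ α₁.length = α₂.length ∧ eval φ α₁ = f₁ ∧ eval φ α₂ = f₂ := by
  obtain ⟨i⟩ := ‹Nonempty ι›
  have : Nonempty ι := ⟨i⟩
  obtain ⟨α, rfl⟩ := exists_eval_eq f₁
  obtain ⟨β, rfl⟩ := exists_eval_eq f₂
  have h1 (n : ℕ) : eval φ (List.replicate n (letter φ i 1)) = 1 := by
    simp [eval, toAmalgam_letter]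
  -- Both words are padded with the letter `1` to the same positive length.
  refine ⟨α ++ List.replicate (β.length + 1) (letter φ i 1),
    β ++ List.replicate (α.length + 1) (letter φ i 1), by simp, by simp, ?_, ?_, ?_⟩
  · simp only [List.length_append, List.length_replicate]
    omega
  · rw [eval_append, h1, mul_one]
  · rw [eval_append, h1, mul_one]

/-- Every element of the amalgam is an element of the common subgroup times a word whose letters
alternate between factors and lie outside that subgroup. -/
theorem exists_eq_base_or_reduced (hφ : ∀ i, Function.Injective (φ i)) (f : PushoutI φ) :
    ∃ (a : A) (w : List (Σ i, G i)), f = PushoutI.base φ a * wordProd φ w ∧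
      w.IsChain (fun c c' => c.1 ≠ c'.1) ∧ ∀ c ∈ w, c.2 ∉ Set.range (φ c.1) := by
  classical
  obtain ⟨d⟩ := PushoutI.NormalWord.transversal_nonempty φ hφ
  obtain ⟨w, rfl⟩ := (PushoutI.NormalWord.equiv (d := d)).symm.surjective f
  refine ⟨w.head, w.toList, ?_, w.chain_ne, ?_⟩
  · change PushoutI.base φ w.head * PushoutI.ofCoprodI w.toWord.prod = _
    rw [CoprodI.Word.prod, map_list_prod, List.map_map, wordProd]
    congr 3
  · rintro ⟨i, g⟩ hc ⟨a, ha⟩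
    -- `φ i a * 1 = 1 * g`, and both `1` and `g` lie in the transversal.
    have := @(d.compl i).1 (⟨⟨φ i a, a, rfl⟩, ⟨1, d.one_mem i⟩⟩)
      (⟨⟨1, one_mem _⟩, ⟨g, w.normalized i g hc⟩⟩) (by simpa using ha)
    simp only [Prod.mk.injEq, Subtype.mk.injEq] at this
    exact w.ne_one _ hc this.2.symm

variable [∀ i, MetricSpace (G i)]

theorem rho_nonneg (α β : List (Letters φ)) : 0 ≤ rho φ α β := by
  refine List.sum_nonneg fun r hr => ?_
  obtain ⟨x, hx⟩ := List.mem_iff_getElem.1 hr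
  obtain ⟨h, rfl⟩ := hx
  rw [List.getElem_zipWith]
  exact amalgDist_nonneg φ _ _

theorem rho_comm (α β : List (Letters φ)) : rho φ α β = rho φ β α := by
  rw [rho, List.zipWith_comm, rho]
  simp only [amalgDist_comm φ]

theorem rho_append {α₁ α₂ : List (Letters φ)} (β₁ β₂ : List (Letters φ))
    (h : α₁.length = α₂.length) :
    rho φ (α₁ ++ β₁) (α₂ ++ β₂) = rho φ α₁ α₂ + rho φ β₁ β₂ := by
  rw [rho, List.zipWith_append h, List.sum_append, rho, rho]

theorem graevDist_nonneg (f₁ f₂ : PushoutI φ) : 0 ≤ graevDist φ f₁ f₂ :=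
  Real.sInf_nonneg (by rintro _ ⟨α, β, -, -, -, -, -, rfl⟩; exact rho_nonneg _ _)

theorem graevDist_comm (f₁ f₂ : PushoutI φ) : graevDist φ f₁ f₂ = graevDist φ f₂ f₁ := by
  unfold graevDist
  congr 1
  ext r
  constructor <;> rintro ⟨α, β, hα, hβ, hl, h₁, h₂, rfl⟩ <;>
    exact ⟨β, α, hβ, hα, hl.symm, h₂, h₁, rho_comm _ _⟩

variable (hφ : ∀ i, Function.Injective (φ i))
  (hagree : ∀ (i j : ι) (a b : A), dist (φ i a) (φ i b) = dist (φ j a) (φ j b))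

include hφ hagree in
theorem rho_self (α : List (Letters φ)) : rho φ α α = 0 := by
  rw [rho, List.zipWith_self]
  refine List.sum_eq_zero fun r hr => ?_
  obtain ⟨x, -, rfl⟩ := List.mem_map.1 hr
  exact amalgDist_self hφ hagree x

include hφ hagree in
/-- Changing the letters of a word one at a time raises the cost of a contraction by at most `ρ`,
up to an arbitrarily small error.  The prefix `p` holds the letters that are already changed. -/
theorem Contracts.of_rho_lt {α β : List (Letters φ)} (hlen : α.length = β.length)
    {p : List (Σ i, G i)} {k : ι} {x : G k} {r t : ℝ} (ht : rho φ α β < t)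
    (h : Contracts φ (p ++ α.map rep) k x r) :
    Contracts φ (p ++ β.map rep) k x (r + t) := by
  induction α generalizing β p r t with
  | nil =>
    obtain rfl : β = [] := List.length_eq_zero_iff.1 hlen.symm
    rw [rho, List.zipWith_nil_left, List.sum_nil] at ht
    exact h.mono (by linarith)
  | cons a α ih =>
    cases β with
    | nil => simp at hlen
    | cons b β =>
      rw [rho, List.zipWith_cons_cons, List.sum_cons, ← rho] at ht
      obtain ⟨s, hs, hs'⟩ := exists_between (lt_sub_iff_add_lt.2 ht)
      have hba : amalgDist φ (letter φ (rep b).1 (rep b).2) (letter φ (rep a).1 (rep a).2) < s := by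
        rw [amalgDist_comm]
        simpa only [letter_rep] using hs
      have h₁ := h.subst (Contracts.of_amalgDist_lt hφ hagree hba)
      have h₂ := ih (β := β) (by simpa using hlen) (p := p ++ [rep b]) (t := t - s)
        (by linarith) (by simpa using h₁)
      exact (by simpa using h₂ : Contracts φ _ _ _ _).mono (by linarith)

variable [Nonempty ι]

include hφ hagree in
/-- Empty words need not be excluded: appending the letter `1` to both words makes them nonempty
and leaves `ρ` unchanged. -/
theorem graevDist_lt_iff {f₁ f₂ : PushoutI φ} {t : ℝ} :
    graevDist φ f₁ f₂ < t ↔ ∃ α₁ α₂ : List (Letters φ), α₁.length = α₂.length ∧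
      eval φ α₁ = f₁ ∧ eval φ α₂ = f₂ ∧ rho φ α₁ α₂ < t := by
  constructor
  · intro h
    obtain ⟨α₁, α₂, h₁, h₂, hl, e₁, e₂⟩ := exists_eval_eq_length_eq f₁ f₂
    obtain ⟨_, ⟨β₁, β₂, -, -, hl, e₁, e₂, rfl⟩, hlt⟩ :=
      exists_lt_of_csInf_lt (by exact ⟨_, α₁, α₂, h₁, h₂, hl, e₁, e₂, rfl⟩) h
    exact ⟨β₁, β₂, hl, e₁, e₂, hlt⟩
  · rintro ⟨α₁, α₂, hl, rfl, rfl, hlt⟩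
    obtain ⟨i⟩ := ‹Nonempty ι›
    have h1 : eval φ [letter φ i 1] = 1 := by simp [eval, toAmalgam_letter]
    refine lt_of_le_of_lt (csInf_le ⟨0, ?_⟩ ?_) hlt
    · rintro _ ⟨β₁, β₂, -, -, -, -, -, rfl⟩
      exact rho_nonneg _ _
    · refine ⟨α₁ ++ [letter φ i 1], α₂ ++ [letter φ i 1], by simp, by simp, by simp [hl],
        by rw [eval_append, h1, mul_one], by rw [eval_append, h1, mul_one], ?_⟩
      rw [rho_append _ _ hl, rho_self hφ hagree, add_zero]

include hφ hagree in
theorem graevDist_self (f : PushoutI φ) : graevDist φ f f = 0 := by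
  refine le_antisymm (le_of_forall_gt fun t ht => ?_) (graevDist_nonneg f f)
  obtain ⟨α, rfl⟩ := exists_eval_eq f
  exact (graevDist_lt_iff hφ hagree).2 ⟨α, α, rfl, rfl, rfl, by rwa [rho_self hφ hagree]⟩

include hφ hagree in
theorem graevDist_mul_mul_le (f₁ f₂ g₁ g₂ : PushoutI φ) :
    graevDist φ (f₁ * g₁) (f₂ * g₂) ≤ graevDist φ f₁ f₂ + graevDist φ g₁ g₂ := by
  refine le_of_forall_gt fun t ht => ?_
  obtain ⟨s, hs, hst⟩ := exists_between (lt_sub_iff_add_lt.2 ht)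
  obtain ⟨α₁, α₂, hα, rfl, rfl, h₁⟩ := (graevDist_lt_iff hφ hagree).1 hs
  obtain ⟨β₁, β₂, hβ, rfl, rfl, h₂⟩ := (graevDist_lt_iff hφ hagree).1 (lt_sub_comm.1 hst)
  refine (graevDist_lt_iff hφ hagree).2 ⟨α₁ ++ β₁, α₂ ++ β₂, by simp [hα, hβ],
    eval_append _ _, eval_append _ _, ?_⟩
  rw [rho_append _ _ hα]
  linarith

include hφ hagree in
theorem isTwoSidedInvariant_graevDist : IsTwoSidedInvariant (graevDist φ) := by
  have left (g f₁ f₂ : PushoutI φ) : graevDist φ (g * f₁) (g * f₂) ≤ graevDist φ f₁ f₂ := by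
    simpa [graevDist_self hφ hagree] using graevDist_mul_mul_le hφ hagree g g f₁ f₂
  have right (g f₁ f₂ : PushoutI φ) : graevDist φ (f₁ * g) (f₂ * g) ≤ graevDist φ f₁ f₂ := by
    simpa [graevDist_self hφ hagree] using graevDist_mul_mul_le hφ hagree f₁ f₂ g g
  intro g f₁ f₂
  refine ⟨le_antisymm (left g f₁ f₂) ?_, le_antisymm (right g f₁ f₂) ?_⟩
  · simpa using left g⁻¹ (g * f₁) (g * f₂)
  · simpa using right g⁻¹ (f₁ * g) (f₂ * g)

include hφ hagree in
theorem graevDist_triangle (f₁ f₂ f₃ : PushoutI φ) :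
    graevDist φ f₁ f₃ ≤ graevDist φ f₁ f₂ + graevDist φ f₂ f₃ := by
  have h := graevDist_mul_mul_le hφ hagree f₁ f₂ (f₂⁻¹ * f₂) (f₂⁻¹ * f₃)
  rw [(isTwoSidedInvariant_graevDist hφ hagree f₂⁻¹ f₂ f₃).1] at h
  simpa using h

variable (htsi : ∀ i, IsTwoSidedInvariant (fun x y : G i => dist x y))

include hφ hagree htsi in
/-- The lower bound for the Graev distance: contractions persist when the product of the word
changes, at a cost arbitrarily close to the Graev distance of the two products. -/
theorem Contracts.of_graevDist_lt {v w : List (Σ i, G i)} {k : ι} {x : G k} {r t : ℝ}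
    (h : Contracts φ v k x r) (ht : graevDist φ (wordProd φ v) (wordProd φ w) < t) :
    Contracts φ w k x (r + t) := by
  obtain ⟨α, β, hl, hα, hβ, hlt⟩ := (graevDist_lt_iff hφ hagree).1 ht
  rw [eval_eq_wordProd] at hα hβ
  exact (Contracts.of_rho_lt hφ hagree hl (p := []) hlt
    (h.of_wordProd_eq htsi hagree hα.symm)).of_wordProd_eq htsi hagree hβ

include hφ hagree htsi in
theorem graevDist_toAmalgam (x y : Letters φ) :
    graevDist φ (toAmalgam φ x) (toAmalgam φ y) = amalgDist φ x y := by
  refine le_antisymm (le_of_forall_gt fun t ht => ?_)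
    (le_of_forall_gt_imp_ge_of_dense fun t ht => ?_)
  · exact (graevDist_lt_iff hφ hagree).2 ⟨[x], [y], rfl, by simp [eval], by simp [eval],
      by simpa [rho] using ht⟩
  · obtain ⟨i, g, rfl⟩ := exists_letter_eq φ x
    obtain ⟨j, h, rfl⟩ := exists_letter_eq φ y
    have hc := (Contracts.single (φ := φ) i g).of_graevDist_lt hφ hagree htsi (w := [⟨j, h⟩])
      (t := t) (by simpa [wordProd, toAmalgam_letter] using ht)
    rw [zero_add] at hc
    rw [amalgDist_comm]
    exact hc.amalgDist_le hφ hagree htsi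

include hφ hagree htsi in
/-- Write `f = a w` with `w` reduced.  As the common subgroup is closed, the letters of `w` stay at
some distance `δ > 0` from it.  If `f` had Graev distance zero from `1`, then `w` would contract
to `a⁻¹` at cost less than `δ`, which forces `w` to be empty. -/
theorem eq_one_of_graevDist_eq_zero (hclosed : ∀ i, IsClosed (Set.range (φ i)))
    {f : PushoutI φ} (hf : graevDist φ f 1 = 0) : f = 1 := by
  obtain ⟨i⟩ := ‹Nonempty ι›
  have : Nonempty ι := ⟨i⟩
  obtain ⟨a, w, rfl, hchain, hw⟩ := exists_eq_base_or_reduced hφ f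
  have hbase (b : A) : wordProd φ [⟨i, φ i b⟩] = PushoutI.base φ b := by
    simp [wordProd, PushoutI.of_apply_eq_base]
  obtain ⟨δ, hδ₀, hδ⟩ : ∃ δ > 0, ∀ c ∈ w, ∀ b : A, δ ≤ dist c.2 (φ c.1 b) := by
    clear hchain hf
    induction w with
    | nil => exact ⟨1, one_pos, by simp⟩
    | cons c w ih =>
      obtain ⟨δ, hδ₀, hδ⟩ := ih fun c' hc' => hw c' (by simp [hc'])
      obtain ⟨ε, hε₀, hε⟩ := Metric.isOpen_iff.1 (hclosed c.1).isOpen_compl c.2 (hw c (by simp))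
      refine ⟨min δ ε, lt_min hδ₀ hε₀, ?_⟩
      intro c' hc' b
      rcases List.mem_cons.1 hc' with rfl | hc'
      · refine (min_le_right _ _).trans (not_lt.1 fun hlt => ?_)
        exact hε (Metric.mem_ball'.2 hlt) ⟨b, rfl⟩
      · exact (min_le_left _ _).trans (hδ c' hc' b)
  have hd : graevDist φ (wordProd φ [⟨i, φ i a⁻¹⟩]) (wordProd φ w) = 0 := by
    rw [hbase, graevDist_comm, ← hf,
      ← (isTwoSidedInvariant_graevDist hφ hagree (PushoutI.base φ a) _ _).1]
    simp
  have hc := (Contracts.single (φ := φ) i (φ i a⁻¹)).of_graevDist_lt hφ hagree htsi (w := w)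
    (t := δ / 2) (by linarith)
  rcases hc.eq_nil_or_singleton hagree htsi hchain hδ (by linarith) with ⟨rfl, -⟩ | ⟨g, rfl, hg⟩
  · have h₁ := graevDist_toAmalgam hφ hagree htsi (letter φ i (φ i a)) (letter φ i 1)
    have e₁ : toAmalgam φ (letter φ i (φ i a)) = PushoutI.base φ a :=
      PushoutI.of_apply_eq_base φ i a
    have e₂ : toAmalgam φ (letter φ i 1) = 1 := map_one (PushoutI.of i)
    have e₃ : wordProd φ [] = 1 := rfl
    rw [e₃, mul_one] at hf ⊢
    rw [e₁, e₂, hf, amalgDist_same φ hφ hagree] at h₁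
    rw [← e₁, dist_eq_zero.1 h₁.symm, e₂]
  · linarith [hδ ⟨i, g⟩ (by simp) a⁻¹]

end GraevDist

end GraevAmalgam

theorem mainTheorem1 {ι : Type*} [Nonempty ι] {G : ι → Type*} {A : Type*}
    [∀ i, Group (G i)] [Group A] [∀ i, MetricSpace (G i)]
    (htsi : ∀ i, IsTwoSidedInvariant (fun x y : G i => dist x y))
    (φ : ∀ i, A →* G i) (hφ : ∀ i, Function.Injective (φ i))
    (hclosed : ∀ i, IsClosed (Set.range (φ i)))
    (hagree : ∀ (i j : ι) (a b : A), dist (φ i a) (φ i b) = dist (φ j a) (φ j b)) :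
    (∃ m : MetricSpace (Monoid.PushoutI φ),
        ∀ f₁ f₂ : Monoid.PushoutI φ, m.dist f₁ f₂ = GraevAmalgam.graevDist φ f₁ f₂) ∧
      IsTwoSidedInvariant (GraevAmalgam.graevDist φ) ∧
      ∀ x y : GraevAmalgam.Letters φ,
        GraevAmalgam.graevDist φ (GraevAmalgam.toAmalgam φ x) (GraevAmalgam.toAmalgam φ y) =
          GraevAmalgam.amalgDist φ x y := by
  have hinv := GraevAmalgam.isTwoSidedInvariant_graevDist hφ hagree
  refine ⟨⟨{ dist := GraevAmalgam.graevDist φ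
             dist_self := GraevAmalgam.graevDist_self hφ hagree
             dist_comm := GraevAmalgam.graevDist_comm
             dist_triangle := GraevAmalgam.graevDist_triangle hφ hagree
             eq_of_dist_eq_zero := fun {f₁ f₂} h => ?_ }, fun _ _ => rfl⟩, hinv,
    GraevAmalgam.graevDist_toAmalgam hφ hagree htsi⟩
  refine mul_inv_eq_one.1 (GraevAmalgam.eq_one_of_graevDist_eq_zero hφ hagree htsi hclosed ?_)
  rw [← mul_inv_cancel f₂]
  exact ((hinv f₂⁻¹ f₁ f₂).2).trans h
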